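/- For a finite graph $G$, the choice number $ch(G)$ is the smallest integer $s$ such that for every assignment of a list of $s$ colors to each vertex of $G$ there is a proper coloring of $G$ that assigns to each vertex a color from its list. Let $K_{m*k}$ denote the complete $k$-partite graph with $k$ color classes, each of size $m$. **Theorem 3.1.** If $m$ and $k$ tend to infinity, with no relation assumed between them, then $$ch(K_{m*k}) = (1+o(1))\, k \ln m.$$ That is, for every $\varepsilon>0$ there is an $N$ such that $|ch(K_{m*k}) - k\ln m| \le \varepsilon\, k \ln m$ for all integers $m,k\ge N$. -/

import Mathlib

/-- `G` is `s`-choosable: for every assignment of a list of exactly `s` colors to each vertex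
(the colors coming from an arbitrary type), there is a proper coloring of `G` in which each vertex
receives a color from its own list. -/
def SimpleGraph.IsChoosable {V : Type*} (G : SimpleGraph V) (s : ℕ) : Prop :=
  ∀ (C : Type) (L : V → Finset C), (∀ v, (L v).card = s) →
    ∃ c : G.Coloring C, ∀ v, c v ∈ L v

/-- The choice number of `G`: the smallest `s` such that `G` is `s`-choosable. (For a finite graph
such an `s` exists, see `SimpleGraph.isLeast_choiceNumber`.) -/
noncomputable def SimpleGraph.choiceNumber {V : Type*} (G : SimpleGraph V) : ℕ :=
  sInf {s : ℕ | G.IsChoosable s}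

/-- A finite graph is `|V|`-choosable, since one can choose pairwise distinct colors. -/
theorem SimpleGraph.isChoosable_card {V : Type*} [Fintype V] (G : SimpleGraph V) :
    G.IsChoosable (Fintype.card V) := by
  classical
  intro C L hL
  obtain ⟨f, hf, hfL⟩ := (Finset.all_card_le_biUnion_card_iff_exists_injective L).1 (by
    intro t
    rcases t.eq_empty_or_nonempty with rfl | ⟨v, hv⟩
    · simp
    · calc t.card ≤ Fintype.card V := Finset.card_le_univ t
        _ = (L v).card := (hL v).symm
        _ ≤ (t.biUnion L).card := Finset.card_le_card (Finset.subset_biUnion_of_mem L hv))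
  exact ⟨SimpleGraph.Coloring.mk f (fun {v w} h e => h.ne (hf e)), hfL⟩

/-- On finite graphs the choice number is attained, so it is a genuine minimum. -/
theorem SimpleGraph.isLeast_choiceNumber {V : Type*} [Fintype V] (G : SimpleGraph V) :
    IsLeast {s : ℕ | G.IsChoosable s} G.choiceNumber :=
  ⟨Nat.sInf_mem ⟨_, G.isChoosable_card⟩, fun _ hs => Nat.sInf_le hs⟩

/-!
Both bounds are probabilistic, with the expectations written as finite sums.

**Upper bound.** Each color is independently put in reserve with probability `δ`, and otherwise
handed to a uniformly random part of the graph. A vertex is *missed* if no color of its list was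
handed to its own part. With lists of size `s ≥ (1 + 3δ) k log m` a vertex is missed with
probability at most `1 / m`, so at most `k` vertices are missed in expectation, whereas a list
contains about `δ s`, far more than `2k`, reserve colors. Some outcome therefore has fewer missed
vertices than reserve colors in any single list. The vertices that are not missed take a color
handed to their part, and the missed ones get pairwise distinct reserve colors by Hall's theorem.
No relation between `k` and `m` is needed because the few missed vertices are repaired instead of
being excluded by a union bound. See `exists_coloring_of_reserve`, `exists_list_coloring` and
`isChoosable_completeEquipartiteGraph_of_mul_log_le`.

**Lower bound.** Fix a large integer `q`. For `s = (1 - η) q log m`, a random family of `m` sets of size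
`s` in a ground set of `(q + 2) s` points has no transversal of size `s`
(`exists_family_forall_exists_disjoint`, `choose_mul_pow_lt`). Replace every point by `t` copies,
`t = ⌊k / (q + 2)⌋`, and use the resulting `m` sets of size `s t` as the lists in each of the `k`
parts. The colors used on one part project to a transversal, so each part uses at least `s + 1`
colors; different parts use disjoint sets of colors, and only `(q + 2) s t ≤ k s` are available
(`not_isChoosable_of_family`). Since `q` does not depend on `k`, the size of `k` relative to `m`
plays no role.
-/

/-! ### Independent random assignments -/

open Finset in
/-- If the values `f c` are independent with common weights `w`, then the expectation of
`∏ c ∈ S, g (f c)` is the `#S`-th power of the expectation of `g`. -/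
theorem sum_prod_mul_prod_eq_pow {C ι : Type*} [Fintype C] [DecidableEq C] [Fintype ι]
    (w g : ι → ℝ) (hw : ∑ x, w x = 1) (S : Finset C) :
    ∑ f : C → ι, (∏ c, w (f c)) * ∏ c ∈ S, g (f c) = (∑ x, w x * g x) ^ #S := by
  have h1 : ∀ f : C → ι, (∏ c, w (f c)) * ∏ c ∈ S, g (f c) =
      ∏ c, w (f c) * (if c ∈ S then g (f c) else 1) := by
    intro f
    rw [prod_mul_distrib, prod_ite_mem, univ_inter]
  have h2 : ∀ c : C, ∑ x, w x * (if c ∈ S then g x else 1) =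
      if c ∈ S then ∑ x, w x * g x else 1 := by
    intro c
    split_ifs <;> simp [hw]
  rw [sum_congr rfl fun f _ => h1 f,
    ← Fintype.prod_sum (fun c x => w x * (if c ∈ S then g x else 1)),
    prod_congr rfl fun c _ => h2 c, prod_ite_mem, univ_inter, prod_const]

/-! ### The upper bound -/

open Finset in
/-- Here `f c = some i` means that the color `c` is handed to the part `i`, and `f c = none` that it
is in reserve. If every list has at least as many reserve colors as there are vertices without a
color handed to their own part, then these vertices can be given distinct reserve colors. -/
theorem exists_coloring_of_reserve {V C ι : Type*} [Fintype V] (part : V → ι)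
    (L : V → Finset C) (f : C → Option ι) [DecidablePred fun u => ∀ c ∈ L u, f c ≠ some (part u)]
    [DecidablePred fun c => f c = none]
    (h : ∀ v, #{u | ∀ c ∈ L u, f c ≠ some (part u)} ≤ #{c ∈ L v | f c = none}) :
    ∃ col : V → C, (∀ v, col v ∈ L v) ∧ ∀ v w, part v ≠ part w → col v ≠ col w := by
  classical
  let B : Finset V := {u | ∀ c ∈ L u, f c ≠ some (part u)}
  obtain ⟨g, hg, hgL⟩ := (all_card_le_biUnion_card_iff_exists_injective
      (fun v : B => {c ∈ L v | f c = none})).1 (by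
    intro t
    rcases t.eq_empty_or_nonempty with rfl | ⟨v, hv⟩
    · simp
    · calc #t ≤ Fintype.card B := card_le_univ t
        _ = #B := Fintype.card_coe B
        _ ≤ #{c ∈ L v | f c = none} := h v
        _ ≤ _ := card_le_card
          (subset_biUnion_of_mem (fun v : B => {c ∈ L v | f c = none}) hv))
  have hgood : ∀ v, v ∉ B → ∃ c ∈ L v, f c = some (part v) := by
    intro v hv
    simpa [B] using hv
  choose good hgoodL hgoodf using hgood
  have hgL' : ∀ v : B, g v ∈ L v ∧ f (g v) = none := fun v => by simpa using hgL v
  refine ⟨fun v => if hv : v ∈ B then g ⟨v, hv⟩ else good v hv, fun v => ?_, fun v w hvw => ?_⟩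
  · by_cases hv : v ∈ B
    · simpa [hv] using (hgL' ⟨v, hv⟩).1
    · simpa [hv] using hgoodL v hv
  · by_cases hv : v ∈ B <;> by_cases hw : w ∈ B <;> simp only [hv, hw, dite_true, dite_false]
    · intro e
      have := hg e
      simp only [Subtype.mk.injEq] at this
      exact hvw (congrArg part this)
    · intro e
      have := (hgL' ⟨v, hv⟩).2
      rw [e, hgoodf w hw] at this
      simp at this
    · intro e
      have := (hgL' ⟨w, hw⟩).2
      rw [← e, hgoodf v hv] at this
      simp at this
    · intro e
      have := hgoodf v hv
      rw [e, hgoodf w hw] at this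
      exact hvw (Option.some.inj this).symm

open Finset in
/-- The hypothesis bounds the expectation of the potential `Φ = M / T + ∑ v, 2 ^ (T - R v)`, where
`M` is the number of missed vertices and `R v` the number of reserve colors in the list of `v`, when
colors are put in reserve with probability `δ` and otherwise handed to a uniformly random part. An
assignment with `Φ < 1` has `M < T ≤ R v` for all `v`. -/
theorem exists_list_coloring_of_fintype {V C ι : Type*} [Fintype V] [Fintype C]
    [Fintype ι] [Nonempty ι] (part : V → ι) (L : V → Finset C) {s T : ℕ}
    (hL : ∀ v, #(L v) = s) (hT : 0 < T) {δ : ℝ} (h0 : 0 ≤ δ) (h1 : δ ≤ 1)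
    (h : Fintype.card V * ((1 - (1 - δ) / Fintype.card ι) ^ s / T + 2 ^ T * (1 - δ / 2) ^ s) < 1) :
    ∃ col : V → C, (∀ v, col v ∈ L v) ∧ ∀ v w, part v ≠ part w → col v ≠ col w := by
  classical
  have hk : (0 : ℝ) < Fintype.card ι := by exact_mod_cast Fintype.card_pos
  have hT' : (0 : ℝ) < T := by exact_mod_cast hT
  -- `∏ c ∈ L v, miss (part v) (f c)` is the indicator of `v` being missed, and
  -- `∏ c ∈ L v, half (f c)` is `2 ^ (-R v)`.
  let w : Option ι → ℝ := fun x => x.elim δ fun _ => (1 - δ) / Fintype.card ι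
  have hw0 : ∀ x, 0 ≤ w x := by
    rintro (_ | i)
    · exact h0
    · exact div_nonneg (by linarith) hk.le
  have hw : ∑ x, w x = 1 := by
    simp [w, Fintype.sum_option]
    field_simp
    ring
  let miss : ι → Option ι → ℝ := fun i x => if x = some i then 0 else 1
  let half : Option ι → ℝ := fun x => if x = none then 1 / 2 else 1
  have hmiss : ∀ i, ∑ x, w x * miss i x = 1 - (1 - δ) / Fintype.card ι := by
    intro i
    have : ∀ x, w x * miss i x = w x - if x = some i then (1 - δ) / Fintype.card ι else 0 := by
      intro x
      by_cases hx : x = some i <;> simp [miss, w, hx]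
    rw [sum_congr rfl fun x _ => this x, sum_sub_distrib, hw]
    simp
  have hhalf : ∑ x, w x * half x = 1 - δ / 2 := by
    have : ∀ x, w x * half x = w x - if x = none then δ / 2 else 0 := by
      intro x
      by_cases hx : x = none <;> simp [half, w, hx]
      ring
    rw [sum_congr rfl fun x _ => this x, sum_sub_distrib, hw]
    simp
  let Φ : (C → Option ι) → ℝ := fun f =>
    ∑ v, ((∏ c ∈ L v, miss (part v) (f c)) / T + 2 ^ T * ∏ c ∈ L v, half (f c))
  have hmean : ∑ f, (∏ c, w (f c)) * Φ f < 1 := by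
    refine lt_of_eq_of_lt ?_ h
    simp only [Φ, mul_sum]
    rw [sum_comm]
    have : ∀ v, ∑ f : C → Option ι, (∏ c, w (f c)) *
        ((∏ c ∈ L v, miss (part v) (f c)) / T + 2 ^ T * ∏ c ∈ L v, half (f c)) =
        (1 - (1 - δ) / Fintype.card ι) ^ s / T + 2 ^ T * (1 - δ / 2) ^ s := by
      intro v
      rw [← hmiss (part v), ← hhalf, ← hL v, ← sum_prod_mul_prod_eq_pow w _ hw,
        ← sum_prod_mul_prod_eq_pow w _ hw, sum_div, mul_sum, ← sum_add_distrib]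
      exact sum_congr rfl fun f _ => by ring
    rw [sum_congr rfl fun v _ => this v, sum_const, card_univ, nsmul_eq_mul]
  have htotal : ∑ f : C → Option ι, ∏ c, w (f c) = 1 := by
    simpa using sum_prod_mul_prod_eq_pow w (fun _ => 1) hw (∅ : Finset C)
  obtain ⟨f, hf⟩ : ∃ f, Φ f < 1 := by
    by_contra! hcon
    refine hmean.not_ge ?_
    rw [← htotal]
    exact sum_le_sum fun f _ => le_mul_of_one_le_right (prod_nonneg fun c _ => hw0 _) (hcon f)
  have hm0 : ∀ v, 0 ≤ (∏ c ∈ L v, miss (part v) (f c)) / (T : ℝ) := fun v =>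
    div_nonneg (prod_nonneg fun c _ => by simp only [miss]; split_ifs <;> norm_num) hT'.le
  have hh0 : ∀ v, 0 ≤ (2 : ℝ) ^ T * ∏ c ∈ L v, half (f c) := fun v =>
    mul_nonneg (by positivity) (prod_nonneg fun c _ => by
      simp only [half]; split_ifs <;> norm_num)
  have hB : #{u | ∀ c ∈ L u, f c ≠ some (part u)} < T := by
    have hle : (#{u | ∀ c ∈ L u, f c ≠ some (part u)} : ℝ) / T ≤ Φ f := by
      simp only [Φ, sum_add_distrib, ← sum_div]
      refine le_add_of_le_of_nonneg ?_ (sum_nonneg fun v _ => hh0 v)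
      gcongr
      rw [card_filter]
      push_cast
      refine le_of_eq (sum_congr rfl fun v _ => ?_)
      simp only [miss]
      split_ifs with hv
      · exact (prod_eq_one fun c hc => if_neg (hv c hc)).symm
      · push Not at hv
        obtain ⟨c, hc, hfc⟩ := hv
        exact Eq.symm (prod_eq_zero hc (by simp [hfc]))
    have := (div_lt_one hT').1 (hle.trans_lt hf)
    exact_mod_cast this
  refine exists_coloring_of_reserve part L f fun v => hB.le.trans ?_
  by_contra! hR
  refine hf.not_ge ?_
  have hprod : ∏ c ∈ L v, half (f c) = (1 / 2) ^ #{c ∈ L v | f c = none} := by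
    simp [half, prod_ite]
  calc (1 : ℝ) = 2 ^ T * (1 / 2) ^ T := by rw [← mul_pow]; norm_num
    _ ≤ 2 ^ T * ∏ c ∈ L v, half (f c) := by
      rw [hprod]
      exact mul_le_mul_of_nonneg_left
        (pow_le_pow_of_le_one (by norm_num) (by norm_num) hR.le) (by positivity)
    _ ≤ (∏ c ∈ L v, miss (part v) (f c)) / T + 2 ^ T * ∏ c ∈ L v, half (f c) :=
      le_add_of_nonneg_left (hm0 v)
    _ ≤ Φ f := single_le_sum (f := fun v => (∏ c ∈ L v, miss (part v) (f c)) / (T : ℝ) +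
        2 ^ T * ∏ c ∈ L v, half (f c)) (fun v _ => add_nonneg (hm0 v) (hh0 v)) (mem_univ v)

open Finset in
/-- Only the finitely many colors occurring in the lists matter. -/
theorem exists_list_coloring {V C ι : Type*} [Fintype V] [Fintype ι] [Nonempty ι] (part : V → ι)
    (L : V → Finset C) {s T : ℕ} (hL : ∀ v, #(L v) = s) (hT : 0 < T) {δ : ℝ} (h0 : 0 ≤ δ)
    (h1 : δ ≤ 1)
    (h : Fintype.card V * ((1 - (1 - δ) / Fintype.card ι) ^ s / T + 2 ^ T * (1 - δ / 2) ^ s) < 1) :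
    ∃ col : V → C, (∀ v, col v ∈ L v) ∧ ∀ v w, part v ≠ part w → col v ≠ col w := by
  classical
  obtain ⟨U, hU⟩ : ∃ U : Finset C, ∀ v, ∀ c ∈ L v, c ∈ U :=
    ⟨univ.biUnion L, fun v c hc => mem_biUnion.2 ⟨v, mem_univ v, hc⟩⟩
  obtain ⟨L', hL'U, hL'⟩ : ∃ L' : V → Finset U, (∀ v, ∀ c ∈ L' v, (c : C) ∈ L v) ∧
      ∀ v, #(L' v) = s :=
    ⟨fun v => (L v).subtype (· ∈ U), fun v c hc => mem_subtype.1 hc, fun v => by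
      rw [card_subtype, filter_true_of_mem (hU v), hL v]⟩
  obtain ⟨col, hcol, hne⟩ := exists_list_coloring_of_fintype part L' hL' hT h0 h1 h
  exact ⟨fun v => col v, fun v => hL'U v _ (hcol v),
    fun v w hvw e => hne v w hvw (Subtype.ext e)⟩

theorem isChoosable_completeEquipartiteGraph {k m s T : ℕ} (hk : 0 < k) (hT : 0 < T) {δ : ℝ}
    (h0 : 0 ≤ δ) (h1 : δ ≤ 1)
    (h : (k * m : ℝ) * ((1 - (1 - δ) / k) ^ s / T + 2 ^ T * (1 - δ / 2) ^ s) < 1) :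
    (SimpleGraph.completeEquipartiteGraph k m).IsChoosable s := by
  intro C L hL
  have : Nonempty (Fin k) := ⟨⟨0, hk⟩⟩
  obtain ⟨col, hcol, hne⟩ := exists_list_coloring (Prod.fst : Fin k × Fin m → Fin k) L hL hT h0 h1
    (by rwa [Fintype.card_prod, Fintype.card_fin, Fintype.card_fin, Nat.cast_mul])
  exact ⟨SimpleGraph.Coloring.mk col fun {v w} hvw => hne v w hvw, hcol⟩

/-- The threshold `T = 2 k` is twice the bound `k` on the expected number of missed vertices; the
reserve term `2 ^ T * (1 - δ / 2) ^ s` is at most `exp (-k) / m`. -/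
theorem isChoosable_completeEquipartiteGraph_of_mul_log_le {k m s : ℕ} {δ : ℝ}
    (h0 : 0 < δ) (h1 : δ ≤ 1 / 2) (hm : 12 / δ ≤ Real.log m) (hk : 4 / δ ≤ k)
    (hs : (1 + 3 * δ) * (k * Real.log m) ≤ s) :
    (SimpleGraph.completeEquipartiteGraph k m).IsChoosable s := by
  set x := Real.log m with hx
  have hk0 : (0 : ℝ) < k := lt_of_lt_of_le (by positivity) hk
  have hx0 : 0 < x := lt_of_lt_of_le (by positivity) hm
  have hkN : 0 < k := by exact_mod_cast hk0
  have hm0 : (0 : ℝ) < m := by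
    rcases Nat.eq_zero_or_pos m with rfl | h
    · simp [hx] at hx0
    · exact_mod_cast h
  have hmx : (m : ℝ) = Real.exp x := (Real.exp_log hm0).symm
  rw [div_le_iff₀ h0] at hm hk
  refine isChoosable_completeEquipartiteGraph hkN (T := 2 * k) (by omega) h0.le (by linarith) ?_
  have hk1 : (1 : ℝ) ≤ k := by exact_mod_cast hkN
  have hA : (1 - (1 - δ) / k) ^ s ≤ Real.exp (-x) := by
    calc (1 - (1 - δ) / k) ^ s ≤ Real.exp (-((1 - δ) / k)) ^ s := by
          gcongr
          · rw [sub_nonneg, div_le_one hk0]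
            linarith
          · exact Real.one_sub_le_exp_neg _
      _ = Real.exp (-((1 - δ) / k * s)) := by rw [← Real.exp_nat_mul]; ring_nf
      _ ≤ Real.exp (-x) := by
        gcongr
        calc x ≤ (1 - δ) * (1 + 3 * δ) * x := by
              refine le_mul_of_one_le_left hx0.le ?_
              nlinarith
          _ = (1 - δ) / k * ((1 + 3 * δ) * (k * x)) := by field_simp
          _ ≤ (1 - δ) / k * s := by
              have : 0 ≤ (1 - δ) / k := div_nonneg (by linarith) hk0.le
              gcongr
  have hB : 2 ^ (2 * k) * (1 - δ / 2) ^ s ≤ Real.exp (-x) * Real.exp (-k) := by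
    calc (2 : ℝ) ^ (2 * k) * (1 - δ / 2) ^ s
        ≤ Real.exp 1 ^ (2 * k) * Real.exp (-(δ / 2)) ^ s := by
          have h2 : 0 ≤ 1 - δ / 2 := by linarith
          gcongr
          · linarith [Real.exp_one_gt_d9]
          · exact Real.one_sub_le_exp_neg _
      _ = Real.exp (2 * k - δ / 2 * s) := by
          rw [← Real.exp_nat_mul, ← Real.exp_nat_mul, ← Real.exp_add]
          push_cast
          ring_nf
      _ ≤ Real.exp (-x + -k) := by
          gcongr
          have h2 : k * x ≤ s := by nlinarith [mul_pos hk0 hx0]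
          have h3 : δ * (k * x) ≤ δ * s := by gcongr
          nlinarith
      _ = _ := Real.exp_add _ _
  have hlt : 2 * (k : ℝ) < Real.exp k := by
    calc 2 * (k : ℝ) < Real.exp 1 * k := by
          gcongr
          linarith [Real.exp_one_gt_d9]
      _ ≤ Real.exp 1 * Real.exp (k - 1) := by
          gcongr
          linarith [Real.add_one_le_exp ((k : ℝ) - 1)]
      _ = Real.exp k := by rw [← Real.exp_add]; ring_nf
  calc (k * m : ℝ) * ((1 - (1 - δ) / k) ^ s / (2 * k : ℕ) + 2 ^ (2 * k) * (1 - δ / 2) ^ s)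
      ≤ (k * m : ℝ) * (Real.exp (-x) / (2 * k : ℕ) + Real.exp (-x) * Real.exp (-k)) := by
        gcongr
    _ = 1 / 2 + k / Real.exp k := by
        rw [hmx, Real.exp_neg, Real.exp_neg]
        push_cast
        field_simp
    _ < 1 := by
        have : (k : ℝ) / Real.exp k < 1 / 2 := by
          rw [div_lt_iff₀ (Real.exp_pos _)]
          linarith
        linarith

open Filter in
theorem eventually_choiceNumber_le {ε : ℝ} (h0 : 0 < ε) (h1 : ε ≤ 1) :
    ∀ᶠ p : ℕ × ℕ in atTop ×ˢ atTop,
      ((SimpleGraph.completeEquipartiteGraph p.2 p.1).choiceNumber : ℝ) ≤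
        (1 + ε) * (p.2 * Real.log p.1) := by
  have hlog : Tendsto (fun m : ℕ => Real.log m) atTop atTop :=
    Real.tendsto_log_atTop.comp tendsto_natCast_atTop_atTop
  have hm := hlog.eventually_ge_atTop (12 / (ε / 4))
  have hk : ∀ᶠ k : ℕ in atTop, 4 / (ε / 4) ≤ (k : ℝ) :=
    tendsto_natCast_atTop_atTop.eventually_ge_atTop _
  filter_upwards [hm.prod_inl _, hk.prod_inr _] with ⟨m, k⟩ hm hk
  simp only at hm hk ⊢
  have hx0 : 0 < Real.log m := lt_of_lt_of_le (by positivity) hm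
  have hk0 : (0 : ℝ) < k := lt_of_lt_of_le (by positivity) hk
  have hle : (SimpleGraph.completeEquipartiteGraph k m).choiceNumber ≤
      ⌈(1 + 3 * (ε / 4)) * (k * Real.log m)⌉₊ :=
    Nat.sInf_le (isChoosable_completeEquipartiteGraph_of_mul_log_le (by positivity)
      (by linarith) hm hk (Nat.le_ceil _))
  have hceil := Nat.ceil_lt_add_one
    (show 0 ≤ (1 + 3 * (ε / 4)) * (k * Real.log m) by positivity)
  have hle' : ((SimpleGraph.completeEquipartiteGraph k m).choiceNumber : ℝ) ≤
      ⌈(1 + 3 * (ε / 4)) * (k * Real.log m)⌉₊ := by exact_mod_cast hle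
  have hone : 1 ≤ ε / 4 * (k * Real.log m) := by
    rw [div_le_iff₀ (by positivity)] at hm hk
    have hL : 12 ≤ Real.log m := by nlinarith
    nlinarith
  linarith

/-! ### The lower bound -/

theorem SimpleGraph.IsChoosable.mono {V : Type*} {G : SimpleGraph V} {s t : ℕ}
    (h : G.IsChoosable s) (hst : s ≤ t) : G.IsChoosable t := by
  intro C L hL
  choose L' hL' hcard using fun v => Finset.exists_subset_card_eq (hst.trans (hL v).ge)
  obtain ⟨c, hc⟩ := h C L' hcard
  exact ⟨c, fun v => hL' v (hc v)⟩

theorem SimpleGraph.lt_choiceNumber {V : Type*} [Fintype V] {G : SimpleGraph V} {s : ℕ}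
    (h : ¬ G.IsChoosable s) : s < G.choiceNumber := by
  by_contra! hle
  exact h (G.isLeast_choiceNumber.1.mono hle)

open Finset in
/-- Counting argument: for a fixed `r`-set, `(n.choose s - (n - r).choose s) ^ m` of the
`n.choose s ^ m` families of `s`-sets consist of sets that all meet it. -/
theorem exists_family_forall_exists_disjoint {n s r m : ℕ} (hrn : r ≤ n)
    (h : n.choose r * (n.choose s - (n - r).choose s) ^ m < n.choose s ^ m) :
    ∃ E : Fin m → Finset (Fin n), (∀ j, #(E j) = s) ∧
      ∀ X : Finset (Fin n), #X ≤ r → ∃ j, Disjoint (E j) X := by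
  classical
  let P : Finset (Finset (Fin n)) := powersetCard s univ
  let bad : Finset (Fin n) → Finset (Fin m → Finset (Fin n)) := fun X =>
    Fintype.piFinset fun _ => {A ∈ P | ¬ Disjoint A X}
  have hP : #P = n.choose s := by simp [P]
  have hbad : ∀ X ∈ powersetCard r (univ : Finset (Fin n)),
      #(bad X) = (n.choose s - (n - r).choose s) ^ m := by
    intro X hX
    have hdisj : {A ∈ P | Disjoint A X} = powersetCard s Xᶜ := by
      ext A
      simp [P, mem_powersetCard, subset_compl_iff_disjoint_right, and_comm]
    have := card_filter_add_card_filter_not (s := P) (fun A => Disjoint A X)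
    rw [hdisj, card_powersetCard, card_compl, (mem_powersetCard.1 hX).2, Fintype.card_fin, hP]
      at this
    rw [Fintype.card_piFinset_const, ← this, Nat.add_sub_cancel_left]
  obtain ⟨E, hE, hEbad⟩ : ∃ E ∈ Fintype.piFinset (fun _ : Fin m => P),
      E ∉ (powersetCard r univ).biUnion bad := by
    by_contra! hsub
    have hle := (card_le_card (fun E hE => hsub E hE)).trans card_biUnion_le
    rw [sum_congr rfl hbad, Fintype.card_piFinset_const, hP] at hle
    simp at hle
    omega
  rw [Fintype.mem_piFinset] at hE
  refine ⟨E, fun j => (mem_powersetCard.1 (hE j)).2, fun X hX => ?_⟩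
  obtain ⟨Y, hXY, hY⟩ := exists_superset_card_eq hX (by simpa using hrn)
  by_contra! hcon
  refine hEbad (mem_biUnion.2 ⟨Y, mem_powersetCard.2 ⟨subset_univ _, hY⟩, ?_⟩)
  exact Fintype.mem_piFinset.2 fun j =>
    mem_filter.2 ⟨hE j, fun hd => hcon j (hd.mono_right hXY)⟩

open Finset in
/-- The bad lists are `E j ×ˢ univ`, the same in every part. On each part the first coordinates of
the colors used form a transversal of `E`, so more than `r` colors are used there. -/
theorem not_isChoosable_of_family {k m n s t r : ℕ} (E : Fin m → Finset (Fin n))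
    (hE : ∀ j, #(E j) = s) (hX : ∀ X : Finset (Fin n), #X ≤ r → ∃ j, Disjoint (E j) X)
    (h : n * t < k * (r + 1)) :
    ¬ (SimpleGraph.completeEquipartiteGraph k m).IsChoosable (s * t) := by
  classical
  intro hch
  obtain ⟨c, hc⟩ := hch (Fin n × Fin t) (fun v => E v.2 ×ˢ univ) (fun v => by simp [hE])
  let S : Fin k → Finset (Fin n × Fin t) := fun i => univ.image fun j => c (i, j)
  have hS : ∀ i, r + 1 ≤ #(S i) := by
    intro i
    by_contra! hlt
    obtain ⟨j, hj⟩ := hX ((S i).image Prod.fst) (card_image_le.trans (Nat.lt_succ_iff.1 hlt))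
    have h1 : (c (i, j)).1 ∈ E j := (mem_product.1 (hc (i, j))).1
    exact disjoint_left.1 hj h1
      (mem_image_of_mem _ (mem_image_of_mem (fun j => c (i, j)) (mem_univ j)))
  have hdisj : ∀ i i', i ≠ i' → Disjoint (S i) (S i') := by
    intro i i' hii
    rw [disjoint_left]
    intro x hx hx'
    obtain ⟨j, -, rfl⟩ := mem_image.1 hx
    obtain ⟨j', -, he⟩ := mem_image.1 hx'
    exact c.valid (v := (i', j')) (w := (i, j))
      (by simpa [SimpleGraph.completeEquipartiteGraph_adj] using hii.symm) he
  have hcard : k * (r + 1) ≤ n * t := by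
    calc k * (r + 1) = ∑ _i : Fin k, (r + 1) := by simp
      _ ≤ ∑ i, #(S i) := sum_le_sum fun i _ => hS i
      _ = #(univ.biUnion S) := (card_biUnion fun i _ i' _ => hdisj i i').symm
      _ ≤ n * t := (card_le_univ _).trans (by simp)
  omega

/-- A fixed `s`-set in a ground set of `(q + 2) s` points is disjoint from a proportion of at least
`(q / (q + 1)) ^ s` of all `s`-sets. -/
theorem pow_mul_choose_le (q s : ℕ) :
    q ^ s * ((q + 2) * s).choose s ≤ (q + 1) ^ s * ((q + 2) * s - s).choose s := by
  have h : q ^ s * ((q + 2) * s).descFactorial s ≤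
      (q + 1) ^ s * ((q + 2) * s - s).descFactorial s := by
    rw [Nat.descFactorial_eq_prod_range, Nat.descFactorial_eq_prod_range]
    have hpow : ∀ a : ℕ, a ^ s = ∏ _i ∈ Finset.range s, a := by simp
    rw [hpow q, hpow (q + 1), ← Finset.prod_mul_distrib, ← Finset.prod_mul_distrib]
    refine Finset.prod_le_prod' fun i hi => ?_
    -- With `s = i + j` the factors become `q * ((q + 1) * s + j)` and `(q + 1) * (q * s + j)`.
    obtain ⟨j, rfl⟩ := Nat.exists_eq_add_of_le (Finset.mem_range.1 hi).le
    have h1 : (q + 2) * (i + j) - i = (q + 1) * (i + j) + j := by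
      rw [Nat.sub_eq_iff_eq_add (by nlinarith)]; ring
    have h2 : (q + 2) * (i + j) - (i + j) - i = q * (i + j) + j := by
      rw [Nat.sub_sub, Nat.sub_eq_iff_eq_add (by nlinarith)]; ring
    rw [h1, h2]
    nlinarith
  rw [Nat.descFactorial_eq_factorial_mul_choose, Nat.descFactorial_eq_factorial_mul_choose] at h
  refine Nat.le_of_mul_le_mul_left ?_ s.factorial_pos
  linarith

/-- The proportion `x = exp (-s / q)` is a lower bound for `(q / (q + 1)) ^ s`, and the number of
`s`-sets to be excluded is at most `exp ((q + 2) s)`, so a union bound works once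
`(q + 2) s < m x`. -/
theorem choose_mul_pow_lt {q s m : ℕ} (hq : 0 < q)
    (h : ((q + 2) * s : ℝ) < m * Real.exp (-(s / q))) :
    ((q + 2) * s).choose s * (((q + 2) * s).choose s - ((q + 2) * s - s).choose s) ^ m <
      ((q + 2) * s).choose s ^ m := by
  set n := (q + 2) * s with hn
  set x : ℝ := Real.exp (-(s / q)) with hx
  have hq' : (0 : ℝ) < q := by exact_mod_cast hq
  have hN : (0 : ℝ) < n.choose s := by
    exact_mod_cast Nat.choose_pos (by rw [hn]; nlinarith)
  have ha : (n.choose s : ℝ) * x ≤ (n - s).choose s := by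
    have h1 : (q : ℝ) ^ s * n.choose s ≤ (q + 1) ^ s * (n - s).choose s := by
      exact_mod_cast pow_mul_choose_le q s
    have h2 : ((q : ℝ) + 1) ^ s * x ≤ q ^ s := by
      have h3 : (q : ℝ) + 1 ≤ q * Real.exp (1 / q) := by
        have := Real.add_one_le_exp (1 / (q : ℝ))
        calc (q : ℝ) + 1 = q * (1 / q + 1) := by
              rw [mul_add, mul_one_div_cancel hq'.ne', mul_one, add_comm]
          _ ≤ _ := by gcongr
      calc ((q : ℝ) + 1) ^ s * x ≤ (q * Real.exp (1 / q)) ^ s * x := by gcongr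
        _ = q ^ s * (Real.exp (s * (1 / q)) * x) := by
          rw [mul_pow, ← Real.exp_nat_mul, mul_assoc]
        _ = q ^ s := by
          rw [hx, ← Real.exp_add, mul_one_div, add_neg_cancel, Real.exp_zero, mul_one]
    refine le_of_mul_le_mul_left ?_ (by positivity : (0 : ℝ) < (q + 1) ^ s)
    calc ((q : ℝ) + 1) ^ s * (n.choose s * x) = ((q + 1) ^ s * x) * n.choose s := by ring
      _ ≤ q ^ s * n.choose s := by gcongr
      _ ≤ _ := h1
  have hle : (n - s).choose s ≤ n.choose s := Nat.choose_le_choose s (Nat.sub_le n s)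
  have hsub : ((n.choose s - (n - s).choose s : ℕ) : ℝ) ≤ n.choose s * Real.exp (-x) := by
    rw [Nat.cast_sub hle]
    have := Real.one_sub_le_exp_neg x
    nlinarith
  have hNle : (n.choose s : ℝ) ≤ Real.exp n := by
    calc (n.choose s : ℝ) ≤ 2 ^ n := by exact_mod_cast Nat.choose_le_two_pow n s
      _ ≤ Real.exp 1 ^ n := by
        gcongr
        linarith [Real.add_one_le_exp (1 : ℝ)]
      _ = Real.exp n := by rw [← Real.exp_nat_mul, mul_one]
  have hfin : (n.choose s : ℝ) * ((n.choose s - (n - s).choose s : ℕ) : ℝ) ^ m <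
      n.choose s ^ m := by
    calc (n.choose s : ℝ) * ((n.choose s - (n - s).choose s : ℕ) : ℝ) ^ m
        ≤ Real.exp n * (n.choose s * Real.exp (-x)) ^ m := by gcongr
      _ = n.choose s ^ m * Real.exp (n + m * -x) := by
        rw [mul_pow, ← Real.exp_nat_mul, Real.exp_add]; ring
      _ < n.choose s ^ m * 1 := by
        gcongr
        rw [Real.exp_lt_one_iff, hn]
        push_cast
        linarith
      _ = _ := mul_one _
  exact_mod_cast hfin

theorem mul_lt_choiceNumber {k m q s t : ℕ} (hq : 0 < q) (hk : 0 < k) (ht : (q + 2) * t ≤ k)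
    (h : ((q + 2) * s : ℝ) < m * Real.exp (-(s / q))) :
    s * t < (SimpleGraph.completeEquipartiteGraph k m).choiceNumber := by
  obtain ⟨E, hE, hX⟩ := exists_family_forall_exists_disjoint (by nlinarith)
    (choose_mul_pow_lt hq h)
  exact SimpleGraph.lt_choiceNumber (not_isChoosable_of_family E hE hX (by nlinarith))

open Filter in
theorem eventually_le_choiceNumber {ε : ℝ} (h0 : 0 < ε) (h1 : ε ≤ 1) :
    ∀ᶠ p : ℕ × ℕ in atTop ×ˢ atTop, (1 - ε) * (p.2 * Real.log p.1) ≤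
      (SimpleGraph.completeEquipartiteGraph p.2 p.1).choiceNumber := by
  -- `q ≥ 8 / ε` makes `q / (q + 2)` at least `1 - ε / 4`.
  obtain ⟨q, hq⟩ := exists_nat_ge (8 / ε)
  have hq0 : (0 : ℝ) < q := lt_of_lt_of_le (by positivity) hq
  have hqN : 0 < q := by exact_mod_cast hq0
  rw [div_le_iff₀ h0] at hq
  have hlog : Tendsto (fun m : ℕ => Real.log m) atTop atTop :=
    Real.tendsto_log_atTop.comp tendsto_natCast_atTop_atTop
  have hexp : ∀ᶠ x : ℝ in atTop, (q + 2) * q * x < Real.exp (ε / 4 * x) := by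
    have hc : (0 : ℝ) < 1 / (2 * ((q + 2) * q)) := by positivity
    filter_upwards [(isLittleO_pow_exp_pos_mul_atTop 1 (show 0 < ε / 4 by positivity)).def hc,
      eventually_ge_atTop 0] with x hx hx0
    rw [pow_one, Real.norm_of_nonneg hx0, Real.norm_of_nonneg (Real.exp_nonneg _),
      one_div_mul_eq_div, le_div_iff₀ (by positivity)] at hx
    have := Real.exp_pos (ε / 4 * x)
    linarith
  have hm := (hlog.eventually hexp).and
    ((hlog.eventually_ge_atTop (4 / ε)).and (eventually_gt_atTop 0))
  have hk : ∀ᶠ k : ℕ in atTop, (q + 2) * (8 / ε) ≤ (k : ℝ) ∧ 0 < k :=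
    (tendsto_natCast_atTop_atTop.eventually_ge_atTop _).and (eventually_gt_atTop 0)
  filter_upwards [hm.prod_inl _, hk.prod_inr _] with ⟨m, k⟩ ⟨hmexp, hmlog, hm0⟩ ⟨hk8, hk0⟩
  simp only at hmexp hmlog hm0 hk8 hk0 ⊢
  set x := Real.log m with hx
  have hx0 : 0 < x := lt_of_lt_of_le (by positivity) hmlog
  rw [div_le_iff₀ h0] at hmlog
  -- The factor `1 - ε / 4` leaves `m * exp (-s / q) ≥ m ^ (ε / 4)`, which beats `(q + 2) * s`.
  set s := ⌊(1 - ε / 4) * (q * x)⌋₊ with hs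
  set t := k / (q + 2) with ht
  have hqx : 0 < q * x := by positivity
  have hsle : (s : ℝ) ≤ (1 - ε / 4) * (q * x) := Nat.floor_le (by
    have : 0 ≤ 1 - ε / 4 := by linarith
    positivity)
  have hsge : (1 - ε / 2) * (q * x) ≤ s := by
    have h2 := Nat.lt_floor_add_one ((1 - ε / 4) * (q * x))
    rw [← hs] at h2
    have hq1 : (1 : ℝ) ≤ q := by exact_mod_cast hqN
    nlinarith
  have htge : (1 - ε / 8) * (k / (q + 2)) ≤ (t : ℝ) := by
    have h2 : (k : ℝ) / (q + 2) < t + 1 := by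
      have := Nat.lt_floor_add_one ((k : ℝ) / ((q + 2 : ℕ) : ℝ))
      rw [Nat.floor_div_eq_div] at this
      exact_mod_cast this
    have h3 : 8 ≤ ε * ((k : ℝ) / (q + 2)) := by
      rw [mul_div_assoc', le_div_iff₀ (by positivity)]
      calc 8 * ((q : ℝ) + 2) = ε * ((q + 2) * (8 / ε)) := by field_simp
        _ ≤ _ := by gcongr
    linarith
  have hcond : ((q + 2) * s : ℝ) < m * Real.exp (-(s / q)) := by
    have hm0' : (0 : ℝ) < m := by exact_mod_cast hm0
    calc ((q + 2) * s : ℝ) ≤ (q + 2) * (q * x) := by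
          gcongr
          nlinarith
      _ = (q + 2) * q * x := by ring
      _ < Real.exp (ε / 4 * x) := hmexp
      _ = m * Real.exp (-((1 - ε / 4) * x)) := by
        nth_rewrite 1 [← Real.exp_log hm0']
        rw [← Real.exp_add, ← hx]
        ring_nf
      _ ≤ _ := by
        gcongr
        rw [div_le_iff₀ hq0]
        linarith
  have hlt := mul_lt_choiceNumber hqN hk0 (Nat.mul_div_le k (q + 2)) hcond
  have hratio : 1 - ε / 4 ≤ (q : ℝ) / (q + 2) := by
    rw [le_div_iff₀ (by positivity)]
    nlinarith
  have hkx : 0 < k * x := by positivity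
  calc (1 - ε) * (k * x) ≤ (1 - ε / 2) * (1 - ε / 8) * (1 - ε / 4) * (k * x) := by
        gcongr
        nlinarith [mul_nonneg h0.le h0.le, mul_nonneg (mul_nonneg h0.le h0.le) (sub_nonneg.2 h1)]
    _ ≤ (1 - ε / 2) * (1 - ε / 8) * (q / (q + 2)) * (k * x) := by
        have : 0 ≤ (1 - ε / 2) * (1 - ε / 8) := mul_nonneg (by linarith) (by linarith)
        gcongr
    _ = ((1 - ε / 2) * (q * x)) * ((1 - ε / 8) * (k / (q + 2))) := by ring
    _ ≤ s * t := by
        have : 0 ≤ 1 - ε / 8 := by linarith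
        gcongr
    _ ≤ _ := by exact_mod_cast hlt.le

/-! ### The asymptotic value -/

/-- `SimpleGraph.completeEquipartiteGraph k m` is the complete `k`-partite graph with parts of
size `m`; the pair `p = (m, k)` tends to infinity in both coordinates independently. -/
theorem theorem3p1 :
    Asymptotics.IsEquivalent (Filter.atTop ×ˢ Filter.atTop : Filter (ℕ × ℕ))
      (fun p : ℕ × ℕ =>
        ((SimpleGraph.completeEquipartiteGraph p.2 p.1).choiceNumber : ℝ))
      (fun p : ℕ × ℕ => (p.2 : ℝ) * Real.log (p.1 : ℝ)) := by
  rw [Asymptotics.IsEquivalent, Asymptotics.isLittleO_iff]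
  intro ε hε
  have h0 : 0 < min ε 1 := lt_min hε one_pos
  filter_upwards [eventually_le_choiceNumber h0 (min_le_right _ _),
    eventually_choiceNumber_le h0 (min_le_right _ _)] with p hlow hup
  have hpos : 0 ≤ (p.2 : ℝ) * Real.log p.1 :=
    mul_nonneg (Nat.cast_nonneg _) (Real.log_natCast_nonneg _)
  have hmin : min ε 1 * ((p.2 : ℝ) * Real.log p.1) ≤ ε * (p.2 * Real.log p.1) := by
    gcongr
    exact min_le_left _ _
  rw [Pi.sub_apply, Real.norm_of_nonneg hpos, Real.norm_eq_abs, abs_le]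
  constructor <;> linarith
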